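/- Let $p$ be a prime, $e$ a positive integer, $q = p^e$, and let $x\mapsto\overline x = x^q$ denote the involutory automorphism of the field $\mathbb F_{q^2}$ (with fixed field $\mathbb F_q$), applied entrywise to matrices. On the set $\mathrm{SL}(2,q^2)$ consider the following permutations: all group automorphisms of $\mathrm{SL}(2,q^2)$, forming the group $\mathfrak A\cong\mathrm{Aut}(\mathrm{SL}(2,q^2))$; the right multiplications $\rho_h\colon x\mapsto xh$, forming the group $R=\{\rho_h\mid h\in\mathrm{SL}(2,q^2)\}$; and $\vartheta_h\colon x\mapsto h^{-1}x\overline h$ for $h\in\mathrm{SL}(2,q^2)$. Let $\mathrm{Aut}(\mathbb F_{q^2})$ act on $\mathrm{SL}(2,q^2)$ entrywise, so that $\mathrm{Aut}(\mathbb F_{q^2})\le\mathfrak A$, and let $\mathfrak A\ltimes R$ be the permutation group generated by $\mathfrak A$ and $R$. Let $T=\left\{\begin{pmatrix}1&x\\0&1\end{pmatrix}\,\middle|\, x\in\mathbb F_{q^2}\right\}$, let $\Omega$ be the set of all $g\in\mathrm{SL}(2,q^2)$ whose lower left entry lies in $\mathbb F_q$, and put $$A=\{Tg\mid g\in\Omega\}\cup\{gT\mid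 g\in\mathrm{SL}(2,q^2)\smallsetminus\Omega\},\qquad \pi_{\mathsf{sq}}=\{A\cdot\vartheta_h\mid h\in\mathrm{SL}(2,q^2)\}.$$ Let $\Gamma$ be the stabilizer of $\pi_{\mathsf{sq}}$ in $\mathfrak A\ltimes R$, and let $\mathrm{P\Sigma L}(2,q^2)=\mathrm{PSL}(2,q^2)\rtimes\mathrm{Aut}(\mathbb F_{q^2})$, where field automorphisms act entrywise. **Theorem.** (a) $\Gamma=\bigl(\langle\vartheta_h\mid h\in\mathrm{SL}(2,q^2)\rangle\rtimes\mathrm{Aut}(\mathbb F_{q^2})\bigr)\times\langle\rho_{-\mathbb 1}\rangle$ (internal semidirect and direct products), and $\Gamma\cong\mathrm{P\Sigma L}(2,q^2)\times\langle\rho_{-\mathbb 1}\rangle$. Here $\langle\rho_{-\mathbb 1}\rangle$ is cyclic of order $2$ if $p$ is odd, so that $\Gamma\cong\mathrm{P\Sigma L}(2,q^2)\times C_2$, and it is trivial if $p=2$, so that $\Gamma\cong\mathrm{P\Sigma L}(2,q^2)$. (b) $\#\Gamma=2e(q^2-1)q^2(q^2+1)$. -/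

import Mathlib

open scoped Pointwise MatrixGroups

/-- `H` is the internal semidirect product `N ⋊ K` of its subgroups `N` (normal) and `K`. -/
structure IsInternalSemidirect {G : Type*} [Group G] (H N K : Subgroup G) : Prop where
  sup_eq : N ⊔ K = H
  le_normalizer : K ≤ Subgroup.normalizer (N : Set G)
  disjoint : Disjoint N K

/-- `H` is the internal direct product `N × K` of its subgroups `N` and `K`. -/
structure IsInternalDirect {G : Type*} [Group G] (H N K : Subgroup G) : Prop where
  sup_eq : N ⊔ K = H
  commute : ∀ x ∈ N, ∀ y ∈ K, x * y = y * x
  disjoint : Disjoint N K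

namespace SLUnital

section field

variable (K : Type*) [Field K]

/-- The permutation group `𝔄` on `SL(2,K)` of all group automorphisms of `SL(2,K)`. -/
def autPerms : Subgroup (Equiv.Perm SL(2, K)) :=
  (MulAut.toPerm SL(2, K)).range

/-- The permutation `ρ_h : x ↦ x * h` of `SL(2,K)`. -/
def rho {K : Type*} [Field K] (h : SL(2, K)) : Equiv.Perm SL(2, K) :=
  Equiv.mulRight h

/-- The permutation group `R = {ρ_h | h ∈ SL(2,K)}`. -/
def rightMults : Subgroup (Equiv.Perm SL(2, K)) where
  carrier := {σ | ∃ h : SL(2, K), σ = rho h}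
  one_mem' := ⟨1, by ext x; simp [rho]⟩
  mul_mem' := by
    rintro _ _ ⟨g, rfl⟩ ⟨h, rfl⟩
    exact ⟨h * g, Equiv.ext fun x => mul_assoc x h g⟩
  inv_mem' := by
    rintro _ ⟨g, rfl⟩
    exact ⟨g⁻¹, Equiv.ext fun x => rfl⟩

/-- The permutation group `𝔄 ⋉ R`, as the subgroup generated by `𝔄` and `R`; see
`autRight_isInternalSemidirect`. -/
def autRight : Subgroup (Equiv.Perm SL(2, K)) :=
  rightMults K ⊔ autPerms K

theorem autRight_isInternalSemidirect :
    IsInternalSemidirect (autRight K) (rightMults K) (autPerms K) where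
  sup_eq := rfl
  le_normalizer := by
    rintro _ ⟨α, rfl⟩
    have key : ∀ β : MulAut SL(2, K), ∀ σ ∈ rightMults K,
        MulAut.toPerm _ β * σ * (MulAut.toPerm _ β)⁻¹ ∈ rightMults K := by
      rintro β _ ⟨h, rfl⟩
      refine ⟨β h, Equiv.ext fun x => ?_⟩
      change β (β⁻¹ x * h) = x * β h
      rw [map_mul, MulAut.apply_inv_self]
    rw [Subgroup.mem_normalizer_iff]
    refine fun σ => ⟨key α σ, fun hσ => ?_⟩
    have h2 := key α⁻¹ _ hσ
    rw [map_inv] at h2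
    convert h2 using 1
    group
  disjoint := by
    rw [Subgroup.disjoint_def]
    rintro _ ⟨h, rfl⟩ ⟨α, hα⟩
    have h1 : α 1 = 1 * h := congrArg (fun σ : Equiv.Perm SL(2, K) => σ 1) hα
    rw [map_one, one_mul] at h1
    subst h1
    exact Equiv.ext fun x => mul_one x

/-- The action of field automorphisms on `SL(2,K)`, entrywise on matrices. -/
def fieldAut : (K ≃+* K) →* MulAut SL(2, K) where
  toFun σ :=
    { Matrix.SpecialLinearGroup.map (n := Fin 2) (σ : K →+* K) with
      invFun := Matrix.SpecialLinearGroup.map (n := Fin 2) (σ.symm : K →+* K)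
      left_inv := fun g => by ext i j; simp
      right_inv := fun g => by ext i j; simp }
  map_one' := by ext g i j; rfl
  map_mul' σ τ := by ext g i j; rfl

/-- `Aut(K)` as a group of permutations of `SL(2,K)`. -/
def fieldAutPerms : Subgroup (Equiv.Perm SL(2, K)) :=
  ((MulAut.toPerm SL(2, K)).comp (fieldAut K)).range

/-- The action of group automorphisms of `G` on `G / Z(G)`. -/
def quotientCenterAut (G : Type*) [Group G] : MulAut G →* MulAut (G ⧸ Subgroup.center G) where
  toFun α := QuotientGroup.congr _ _ α
    (Subgroup.characteristic_iff_map_eq.mp Subgroup.centerCharacteristic α)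
  map_one' := by ext ⟨x⟩; rfl
  map_mul' α β := by ext ⟨x⟩; rfl

/-- The action of `Aut(K)` on `PSL(2,K)`, entrywise on matrices. -/
def fieldAutPSL : (K ≃+* K) →* MulAut PSL(2, K) :=
  (quotientCenterAut SL(2, K)).comp (fieldAut K)

/-- `PΣL(2,K) = PSL(2,K) ⋊ Aut(K)`. -/
abbrev PSigmaL : Type _ := PSL(2, K) ⋊[fieldAutPSL K] (K ≃+* K)

/-- The subgroup `T` of all matrices `(1 x; 0 1)`, as a set. -/
def T : Set SL(2, K) :=
  {g | ∃ x : K, (g : Matrix (Fin 2) (Fin 2) K) = !![1, x; 0, 1]}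

end field

/-! In the following, `K` is meant to be a field with `q²` elements, where `q = p ^ e`. -/

section square

variable (K : Type*) [Field K] (p e : ℕ) [ExpChar K p]

/-- The map `x ↦ x̄ = x ^ q` with `q = p ^ e`, applied entrywise to matrices. -/
def bar : SL(2, K) →* SL(2, K) :=
  Matrix.SpecialLinearGroup.map (iterateFrobenius K p e)

/-- The permutation `ϑ_h : x ↦ h⁻¹ * x * h̄` of `SL(2,K)`. -/
def vartheta (h : SL(2, K)) : Equiv.Perm SL(2, K) where
  toFun x := h⁻¹ * x * bar K p e h
  invFun x := h * x * (bar K p e h)⁻¹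
  left_inv x := by group
  right_inv x := by group

/-- The group `⟨ϑ_h | h ∈ SL(2,K)⟩`. -/
def varthetaGroup : Subgroup (Equiv.Perm SL(2, K)) :=
  Subgroup.closure (Set.range (vartheta K p e))

/-- `Ω`: the matrices `g ∈ SL(2,K)` whose lower left entry `(0,1) * g * (1,0)ᵗ` lies in the subfield
`𝔽_q = {y | y ^ q = y}` of `K`. -/
def Omega : Set SL(2, K) :=
  {g | (g : Matrix (Fin 2) (Fin 2) K) 1 0 ^ p ^ e = (g : Matrix (Fin 2) (Fin 2) K) 1 0}

/-- `A = {T g | g ∈ Ω} ∪ {g T | g ∉ Ω}`. -/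
def classA : Set (Set SL(2, K)) :=
  {B | ∃ g ∈ Omega K p e, B = {x | ∃ t ∈ T K, x = t * g}} ∪
    {B | ∃ g ∉ Omega K p e, B = {x | ∃ t ∈ T K, x = g * t}}

/-- The parallelism `π_sq = {A · ϑ_h | h ∈ SL(2,K)}`. The action of permutations of `SL(2,K)` on
sets of subsets of `SL(2,K)` is the natural (elementwise) one. -/
def piSq : Set (Set (Set SL(2, K))) :=
  {X | ∃ h : SL(2, K), X = vartheta K p e h • classA K p e}

/-- `Γ`: the stabilizer of `π_sq` in `𝔄 ⋉ R`. -/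
def stabGamma : Subgroup (Equiv.Perm SL(2, K)) :=
  autRight K ⊓ MulAction.stabilizer (Equiv.Perm SL(2, K)) (piSq K p e)

end square

end SLUnital

/-! Write φ for the map x ↦ x^q. The ϑ_h permute the classes A·ϑ_g transitively, while field
automorphisms and ρ_{-1} fix A and normalise the set of all ϑ_h; so all of these lie in Γ.

For the converse, every automorphism of SL(2,K) has the form x ↦ a σ(x) a⁻¹ with σ a field
automorphism (`exists_semilinear_of_mulAut`). Since σ stabilizes π_sq, it may be divided out of an
element of Γ, leaving γ : x ↦ a x b. For every h some ϑ_{h'}⁻¹ γ ϑ_h fixes A, which forces its two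
matrices to be upper triangular (`triangular_of_smul_classA`). The product b·φ(a) changes only by
conjugation with φ(h) in this passage, so all these conjugates are triangular and b·φ(a) is a scalar
μ. Moreover μ·det a lies in 𝔽_q. These conditions make det a a square, so a can be scaled into
SL(2,K), and γ is ϑ_g up to sign (`eq_vartheta_of_smul_piSq`).

The structure of Γ follows because PΣL(2,K) acts faithfully and meets ⟨ρ_{-1}⟩ trivially
(`eq_one_of_pSigmaLHom_mem_zpowers`). -/

namespace SLUnital

open Matrix

/-! ### Automorphisms of SL(2,K) for finite K -/

section automorphisms

variable {K : Type*} [Field K]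

/-- The matrix `(1 x; 0 1)`. -/
def upper (x : K) : SL(2, K) := ⟨!![1, x; 0, 1], by simp [det_fin_two]⟩

/-- The matrix `(1 0; x 1)`. -/
def lower (x : K) : SL(2, K) := ⟨!![1, 0; x, 1], by simp [det_fin_two]⟩

@[simp] lemma coe_upper (x : K) : (upper x : Matrix (Fin 2) (Fin 2) K) = !![1, x; 0, 1] := rfl

@[simp] lemma coe_lower (x : K) : (lower x : Matrix (Fin 2) (Fin 2) K) = !![1, 0; x, 1] := rfl

lemma upper_mul (x y : K) : upper x * upper y = upper (x + y) := by
  apply Subtype.ext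
  simp [Matrix.SpecialLinearGroup.coe_mul, add_comm]

lemma lower_mul (x y : K) : lower x * lower y = lower (x + y) := by
  apply Subtype.ext
  simp [Matrix.SpecialLinearGroup.coe_mul]

/-- `x ↦ (1 x; 0 1)` as a homomorphism. -/
def upperHom : Multiplicative K →* SL(2, K) where
  toFun x := upper x.toAdd
  map_one' := by apply Subtype.ext; simp [← Matrix.one_fin_two]
  map_mul' x y := (upper_mul _ _).symm

/-- `x ↦ (1 0; x 1)` as a homomorphism. -/
def lowerHom : Multiplicative K →* SL(2, K) where
  toFun x := lower x.toAdd
  map_one' := by apply Subtype.ext; simp [← Matrix.one_fin_two]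
  map_mul' x y := (lower_mul _ _).symm

lemma transvection_zero_one (x : K) :
    Matrix.SpecialLinearGroup.transvection zero_ne_one x = upper x := by
  ext i j
  fin_cases i <;> fin_cases j <;> simp [Matrix.SpecialLinearGroup.transvection_coe]

lemma transvection_one_zero (x : K) :
    Matrix.SpecialLinearGroup.transvection one_ne_zero x = lower x := by
  ext i j
  fin_cases i <;> fin_cases j <;> simp [Matrix.SpecialLinearGroup.transvection_coe]

/-- `SL(2,K)` is generated by the matrices `(1 x; 0 1)` and `(1 0; x 1)`. -/
theorem upper_lower_induction {P : SL(2, K) → Prop} (hu : ∀ x, P (upper x))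
    (hl : ∀ x, P (lower x)) (hmul : ∀ A B, P A → P B → P (A * B)) (A : SL(2, K)) : P A := by
  refine SL2.transvection_induction P (fun i j h c => ?_) hmul A
  fin_cases i <;> fin_cases j
  · exact absurd rfl h
  · have := hu c
    rwa [← transvection_zero_one] at this
  · have := hl c
    rwa [← transvection_one_zero] at this
  · exact absurd rfl h

/-- A homomorphic image of the additive group of a finite field of characteristic `p` in `SL(2,K)`
fixes a nonzero vector. -/
theorem exists_fixed_vector (p : ℕ) [Fact p.Prime] [CharP K p] [Finite K]
    (β : Multiplicative K →* SL(2, K)) :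
    ∃ v : Fin 2 → K, v ≠ 0 ∧ ∀ x, (β x : Matrix (Fin 2) (Fin 2) K) *ᵥ v = v := by
  have hp : IsPGroup p β.range := by
    rintro ⟨_, x, rfl⟩
    refine ⟨1, Subtype.ext ?_⟩
    have : x ^ p = 1 := by
      apply Multiplicative.toAdd.injective
      simp
    simp [← map_pow, this]
  have hdvd : p ∣ Nat.card (Fin 2 → K) := by
    have := Fintype.ofFinite K
    obtain ⟨n, -, hn⟩ := FiniteField.card K p
    rw [Nat.card_fun, Nat.card_eq_fintype_card, hn]
    simp only [Nat.card_eq_fintype_card, Fintype.card_fin, ← pow_mul]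
    exact dvd_pow_self p (by simp)
  -- The number of fixed points of a p-group on K² is divisible by p, and 0 is one of them.
  obtain ⟨v, hv, hv0⟩ := hp.exists_fixed_point_of_prime_dvd_card_of_fixed_point (Fin 2 → K) hdvd
    (a := 0) (fun g => smul_zero _)
  exact ⟨v, hv0.symm, fun x => hv ⟨β x, x, rfl⟩⟩

/-- Every element of a finite field is a difference of two squares. -/
theorem exists_sq_sub_sq [Finite K] (y : K) : ∃ s t : K, y = s ^ 2 - t ^ 2 := by
  by_cases h2 : (2 : K) = 0
  · have := Fintype.ofFinite K
    have : CharP K 2 := CharTwo.of_one_ne_zero_of_two_eq_zero one_ne_zero h2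
    obtain ⟨s, hs⟩ := FiniteField.isSquare_of_char_two (ringChar.eq K 2) y
    exact ⟨s, 0, by rw [hs]; ring⟩
  · exact ⟨(y + 1) / 2, (y - 1) / 2, by field_simp; ring⟩

/-- An additive endomorphism of a finite field that fixes `1` and is multiplicative when one of the
factors is a square comes from an automorphism. -/
theorem exists_ringEquiv_of_map_sq_mul [Finite K] (F : K →+ K) (h1 : F 1 = 1)
    (hF : ∀ t x, F (t ^ 2 * x) = F (t ^ 2) * F x) : ∃ σ : K ≃+* K, ∀ x, σ x = F x := by
  let G : K →+* K :=
    { F with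
      map_one' := h1
      map_zero' := F.map_zero
      map_add' := F.map_add
      map_mul' := fun x y => by
        obtain ⟨s, t, rfl⟩ := exists_sq_sub_sq x
        change F _ = F _ * F _
        rw [sub_mul, map_sub, map_sub, hF, hF, sub_mul] }
  exact ⟨RingEquiv.ofBijective G (Finite.injective_iff_bijective.mp G.injective), fun x => rfl⟩

lemma coe_fieldAut (σ : K ≃+* K) (x : SL(2, K)) :
    (fieldAut K σ x : Matrix (Fin 2) (Fin 2) K) = (x : Matrix (Fin 2) (Fin 2) K).map σ := rfl

/-- Conjugation by diag(t, t⁻¹) multiplies the parameter of `upper` by t². Hence x ↦ f x / f 1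
respects multiplication by squares and is an automorphism σ. The antidiagonal w interchanges the two
unipotent subgroups and thereby determines g from f. Conjugating by diag(f 1, 1) then turns β into σ
on generators. -/
theorem exists_diag_of_triangular [Finite K] (β : SL(2, K) →* Matrix (Fin 2) (Fin 2) K)
    (f g : K → K) (hf : ∀ x, β (upper x) = !![1, f x; 0, 1])
    (hg : ∀ x, β (lower x) = !![1, 0; g x, 1]) (hf1 : f 1 ≠ 0) :
    ∃ (σ : K ≃+* K) (d : Matrix (Fin 2) (Fin 2) K), d.det ≠ 0 ∧
      ∀ x, β x * d = d * (fieldAut K σ x : Matrix (Fin 2) (Fin 2) K) := by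
  have fadd : ∀ x y, f (x + y) = f x + f y := fun x y => by
    have := congrFun₂ (hf (x + y)) 0 1
    rw [← upper_mul, map_mul, hf, hf] at this
    simpa [add_comm] using this.symm
  have comm : ∀ m x y : SL(2, K), m * x = y * m → β m * β x = β y * β m := fun m x y h => by
    rw [← map_mul, ← map_mul, h]
  -- the image of a diagonal matrix is diagonal
  have hsq : ∀ t x : K, t ≠ 0 → f (t ^ 2 * x) * f 1 = f (t ^ 2) * f x := fun t x ht => by
    let m : SL(2, K) := ⟨!![t, 0; 0, t⁻¹], by simp [det_fin_two, ht]⟩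
    have hu : ∀ x, m * upper x = upper (t ^ 2 * x) * m := fun x => by
      apply Subtype.ext
      rw [Matrix.SpecialLinearGroup.coe_mul, Matrix.SpecialLinearGroup.coe_mul]
      simp [m]
      field_simp
    have e := fun x => comm _ _ _ (hu x)
    have hdet : (β m * β m⁻¹).det = 1 := by rw [← map_mul]; simp
    obtain ⟨a, b, c, d, hm⟩ : ∃ a b c d, β m = !![a, b; c, d] := ⟨_, _, _, _, eta_fin_two _⟩
    have e1 : ∀ x, _ := fun x => by
      have := e x
      rw [hf, hf, hm] at this
      exact this
    have hc : c = 0 := by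
      have := congrFun₂ (e1 1) 1 1
      simp at this
      tauto
    subst hc
    have e2 : ∀ x, a * f x = f (t ^ 2 * x) * d := fun x => by
      have := congrFun₂ (e1 x) 0 1
      simp at this
      linear_combination this
    have hd : d ≠ 0 := by
      rintro rfl
      rw [det_mul, hm] at hdet
      simp [det_fin_two] at hdet
    apply mul_right_cancel₀ hd
    have h1 := e2 1
    rw [mul_one] at h1
    linear_combination f x * h1 - f 1 * e2 x
  let F : K →+ K :=
    { toFun := fun x => f x / f 1
      map_zero' := by
        have := fadd 0 0
        simp at this
        simp [this]
      map_add' := fun x y => by rw [fadd, add_div] }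
  obtain ⟨σ, hσ⟩ := exists_ringEquiv_of_map_sq_mul F (div_self hf1) (fun t x => by
    by_cases ht : t = 0
    · simp [ht]
    · change f _ / f 1 = f _ / f 1 * (f x / f 1)
      have := hsq t x ht
      field_simp
      linear_combination this)
  have hσ' : ∀ x, f x = f 1 * σ x := fun x => by
    rw [hσ]
    exact (mul_div_cancel₀ _ hf1).symm
  -- the image of an antidiagonal matrix is antidiagonal
  have hg' : ∀ x, g x * f 1 = σ x := fun x => by
    let w : SL(2, K) := ⟨!![0, 1; -1, 0], by simp [det_fin_two]⟩
    have hw : w = upper 1 * lower (-1) * upper 1 := by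
      apply Subtype.ext
      simp [w, Matrix.SpecialLinearGroup.coe_mul]
    have hul : ∀ x, w * upper x = lower (-x) * w := fun x => by
      apply Subtype.ext
      rw [Matrix.SpecialLinearGroup.coe_mul, Matrix.SpecialLinearGroup.coe_mul]
      simp [w]
    have hM := congrArg β hw
    rw [map_mul, map_mul, hf, hg] at hM
    have e : ∀ x, _ := fun x => by
      have := comm _ _ _ (hul x)
      rw [hf, hg, hM] at this
      exact this
    -- The left side is the upper left entry of β w.
    have h0 : 1 + f 1 * g (-1) = 0 := by
      have := congrFun₂ (e 1) 0 1
      simp at this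
      tauto
    have := congrFun₂ (e (-x)) 1 1
    simp at this
    rw [hσ' (-x), map_neg] at this
    grind
  refine ⟨σ, !![f 1, 0; 0, 1], by simpa [det_fin_two] using hf1, fun x => ?_⟩
  induction x using upper_lower_induction with
  | hu x =>
    rw [hf, coe_fieldAut]
    ext i j
    fin_cases i <;> fin_cases j <;> simp [hσ' x, Matrix.mul_apply, Fin.sum_univ_two]
  | hl x =>
    rw [hg, coe_fieldAut]
    ext i j
    fin_cases i <;> fin_cases j <;> simp [hg' x, Matrix.mul_apply, Fin.sum_univ_two]
  | hmul A B hA hB =>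
    rw [map_mul, map_mul, Matrix.mul_assoc, hB, ← Matrix.mul_assoc, hA, Matrix.mul_assoc]
    rfl

/-- Every automorphism of `SL(2,K)`, `K` a finite field, is induced by a semilinear map. -/
theorem exists_semilinear_of_mulAut (p : ℕ) [Fact p.Prime] [CharP K p] [Finite K]
    (α : MulAut SL(2, K)) :
    ∃ (σ : K ≃+* K) (a : Matrix (Fin 2) (Fin 2) K), a.det ≠ 0 ∧
      ∀ x, (α x : Matrix (Fin 2) (Fin 2) K) * a =
        a * (fieldAut K σ x : Matrix (Fin 2) (Fin 2) K) := by
  -- Fixed vectors of the images of the two unipotent subgroups will be the new basis, in which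
  -- those images are triangular.
  obtain ⟨v, hv0, hv⟩ := exists_fixed_vector p (α.toMonoidHom.comp upperHom)
  obtain ⟨w, hw0, hw⟩ := exists_fixed_vector p (α.toMonoidHom.comp lowerHom)
  replace hv : ∀ x, (α (upper x) : Matrix (Fin 2) (Fin 2) K) *ᵥ v = v :=
    fun x => hv (Multiplicative.ofAdd x)
  replace hw : ∀ x, (α (lower x) : Matrix (Fin 2) (Fin 2) K) *ᵥ w = w :=
    fun x => hw (Multiplicative.ofAdd x)
  let a : Matrix (Fin 2) (Fin 2) K := !![v 0, w 0; v 1, w 1]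
  have hvw : ∀ M : Matrix (Fin 2) (Fin 2) K, M *ᵥ w = w → (∃ c : K, v = c • w) → M *ᵥ v = v := by
    rintro M hM ⟨c, rfl⟩
    rw [mulVec_smul, hM]
  have hdet : a.det ≠ 0 := fun h0 => by
    simp only [a, det_fin_two_of] at h0
    have hc : ∃ c : K, v = c • w := by
      by_cases hw' : w 0 = 0
      · have hw1 : w 1 ≠ 0 := fun h => hw0 (by ext i; fin_cases i <;> simp [hw', h])
        refine ⟨v 1 / w 1, ?_⟩
        ext i
        fin_cases i
        · simp [hw'] at h0 ⊢
          tauto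
        · simp [hw1]
      · refine ⟨v 0 / w 0, ?_⟩
        ext i
        fin_cases i
        · simp [hw']
        · simp
          field_simp
          linear_combination -h0
    -- If v and w were dependent, all of SL(2,K), being the image of α, would fix v ≠ 0.
    have hall : ∀ x, (α x : Matrix (Fin 2) (Fin 2) K) *ᵥ v = v := fun x => by
      induction x using upper_lower_induction with
      | hu x => exact hv x
      | hl x => exact hvw _ (hw x) hc
      | hmul A B hA hB =>
        rw [map_mul, Matrix.SpecialLinearGroup.coe_mul, ← mulVec_mulVec, hB, hA]
    apply hv0
    have h1 := hall (α.symm (upper 1))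
    have h2 := hall (α.symm (lower 1))
    rw [MulEquiv.apply_symm_apply] at h1 h2
    have h1 := congrFun h1 0
    have h2 := congrFun h2 1
    ext i
    fin_cases i
    · simpa [mulVec, dotProduct, Fin.sum_univ_two] using h2
    · simpa [mulVec, dotProduct, Fin.sum_univ_two] using h1
  have hu : IsUnit a.det := hdet.isUnit
  let β : SL(2, K) →* Matrix (Fin 2) (Fin 2) K :=
    { toFun := fun x => a⁻¹ * (α x : Matrix (Fin 2) (Fin 2) K) * a
      map_one' := by simp [nonsing_inv_mul _ hu]
      map_mul' := fun x y => by
        rw [map_mul, Matrix.SpecialLinearGroup.coe_mul]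
        simp only [Matrix.mul_assoc]
        rw [mul_nonsing_inv_cancel_left _ _ hu] }
  have hβ : ∀ x, a * β x = α x * a := fun x => by
    change a * (a⁻¹ * _ * _) = _
    rw [Matrix.mul_assoc, mul_nonsing_inv_cancel_left _ _ hu]
  have hβdet : ∀ x, (β x).det = 1 := fun x => by
    have := congrArg det (hβ x)
    rw [det_mul, det_mul, Matrix.SpecialLinearGroup.det_coe, one_mul] at this
    exact mul_left_cancel₀ hdet (this.trans (mul_one _).symm)
  have ha0 : a *ᵥ ![1, 0] = v := by
    ext i; fin_cases i <;> simp [a, mulVec, dotProduct, Fin.sum_univ_two]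
  have ha1 : a *ᵥ ![0, 1] = w := by
    ext i; fin_cases i <;> simp [a, mulVec, dotProduct, Fin.sum_univ_two]
  have hinj : Function.Injective (a *ᵥ ·) :=
    mulVec_injective_of_isUnit ((isUnit_iff_isUnit_det a).mpr hu)
  have hf : ∀ x, β (upper x) = !![1, β (upper x) 0 1; 0, 1] := fun x => by
    have h : β (upper x) *ᵥ ![1, 0] = ![1, 0] := hinj (by
      dsimp only
      rw [mulVec_mulVec, hβ, ← mulVec_mulVec, ha0, hv])
    have h0 := congrFun h 0
    have h1 := congrFun h 1
    have h2 := hβdet (upper x)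
    simp [mulVec, dotProduct, Fin.sum_univ_two] at h0 h1
    rw [det_fin_two, h0, h1] at h2
    simp at h2
    ext i j
    fin_cases i <;> fin_cases j <;> simp [h0, h1, h2]
  have hg : ∀ x, β (lower x) = !![1, 0; β (lower x) 1 0, 1] := fun x => by
    have h : β (lower x) *ᵥ ![0, 1] = ![0, 1] := hinj (by
      dsimp only
      rw [mulVec_mulVec, hβ, ← mulVec_mulVec, ha1, hw])
    have h0 := congrFun h 0
    have h1 := congrFun h 1
    have h2 := hβdet (lower x)
    simp [mulVec, dotProduct, Fin.sum_univ_two] at h0 h1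
    rw [det_fin_two, h0, h1] at h2
    simp at h2
    ext i j
    fin_cases i <;> fin_cases j <;> simp [h0, h1, h2]
  have hf1 : β (upper 1) 0 1 ≠ 0 := fun h => by
    have h1 := hf 1
    rw [h, ← Matrix.one_fin_two] at h1
    have h2 := hβ (upper 1)
    rw [h1, mul_one] at h2
    have h3 : (α (upper 1) : Matrix (Fin 2) (Fin 2) K) = 1 := by
      have := congrArg (· * a⁻¹) h2
      simpa [mul_nonsing_inv _ hu, Matrix.mul_assoc] using this.symm
    have h4 : upper (1 : K) = 1 := by
      rw [← map_eq_one_iff α α.injective]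
      exact Subtype.ext h3
    have := congrArg (fun m : SL(2, K) => (m : Matrix (Fin 2) (Fin 2) K) 0 1) h4
    simp at this
  obtain ⟨σ, d, hd, h⟩ := exists_diag_of_triangular β _ _ hf hg hf1
  refine ⟨σ, a * d, by rw [det_mul]; exact mul_ne_zero hdet hd, fun x => ?_⟩
  rw [← Matrix.mul_assoc, ← hβ, Matrix.mul_assoc, h, Matrix.mul_assoc]

end automorphisms

/-! ### Maps x ↦ a x b that stabilize the parallelism -/

section stabilizer

variable {K : Type*} [Field K] {p e : ℕ}

lemma upper_mem_T (x : K) : upper x ∈ T K := ⟨x, rfl⟩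

lemma row_one_of_mem_T {t : SL(2, K)} (ht : t ∈ T K) (g : SL(2, K)) (j : Fin 2) :
    (t * g : SL(2, K)).1 1 j = g.1 1 j := by
  obtain ⟨x, hx⟩ := ht
  rw [Matrix.SpecialLinearGroup.coe_mul, hx]
  fin_cases j <;> simp [Matrix.mul_apply, Fin.sum_univ_two]

lemma col_zero_of_mem_T {t : SL(2, K)} (ht : t ∈ T K) (g : SL(2, K)) (i : Fin 2) :
    (g * t : SL(2, K)).1 i 0 = g.1 i 0 := by
  obtain ⟨x, hx⟩ := ht
  rw [Matrix.SpecialLinearGroup.coe_mul, hx]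
  fin_cases i <;> simp [Matrix.mul_apply, Fin.sum_univ_two]

/-- A class of `classA` either consists of elements of `Ω` with the same second row, or of elements
outside `Ω` with the same first column. -/
lemma rows_or_cols_of_mem_classA {B : Set SL(2, K)} (hB : B ∈ classA K p e) {x y : SL(2, K)}
    (hx : x ∈ B) (hy : y ∈ B) :
    (x ∈ Omega K p e ∧ ∀ j, x.1 1 j = y.1 1 j) ∨ (x ∉ Omega K p e ∧ ∀ i, x.1 i 0 = y.1 i 0) := by
  rcases hB with ⟨g, hg, rfl⟩ | ⟨g, hg, rfl⟩
  · left
    obtain ⟨s, hs, rfl⟩ := hx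
    obtain ⟨t, ht, rfl⟩ := hy
    refine ⟨?_, fun j => by rw [row_one_of_mem_T hs, row_one_of_mem_T ht]⟩
    change _ ^ _ = _
    rw [row_one_of_mem_T hs]
    exact hg
  · right
    obtain ⟨s, hs, rfl⟩ := hx
    obtain ⟨t, ht, rfl⟩ := hy
    refine ⟨fun h => hg ?_, fun j => by rw [col_zero_of_mem_T hs, col_zero_of_mem_T ht]⟩
    change _ ^ _ = _ at h
    rwa [col_zero_of_mem_T hs] at h

/-- A finite field of `q²` elements has elements outside `𝔽_q`. -/
lemma exists_pow_ne [Fact p.Prime] (hK : Nat.card K = (p ^ e) ^ 2) : ∃ y : K, y ^ p ^ e ≠ y := by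
  have hpos : 0 < p := (Fact.out : p.Prime).pos
  have : Finite K := Nat.finite_of_card_ne_zero (by rw [hK]; positivity)
  have := Fintype.ofFinite K
  rw [Nat.card_eq_fintype_card] at hK
  have h1 : 1 < p ^ e := by
    have := Fintype.one_lt_card (α := K)
    rw [hK] at this
    by_contra h
    have : p ^ e = 1 := by have := Nat.pow_pos (n := e) hpos; omega
    simp_all
  by_contra! h
  have := (FiniteField.forall_pow_eq_one_iff K (p ^ e - 1)).mp (fun x => by
    have hx := h x
    ext
    have : (x : K) ^ (p ^ e - 1) * x = 1 * x := by
      rw [← pow_succ, Nat.sub_add_cancel h1.le, hx, one_mul]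
    simpa using this)
  rw [hK] at this
  have := Nat.le_of_dvd (by omega) this
  have : p ^ e < (p ^ e) ^ 2 := by nlinarith
  omega

/-- Euler's criterion: for odd q, raising s^(q-1) = μ² to the power (q+1)/2 gives s^((q²-1)/2) =
μ^(q+1) = 1. In characteristic 2 everything is a square. -/
lemma isSquare_of_pow_eq [Fact p.Prime] (hK : Nat.card K = (p ^ e) ^ 2) {s μ : K} (hs : s ≠ 0)
    (h1 : s ^ p ^ e = s * μ ^ 2) (h2 : μ ^ p ^ e * μ = 1) : IsSquare s := by
  have hpos : 0 < p := (Fact.out : p.Prime).pos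
  have : Finite K := Nat.finite_of_card_ne_zero (by rw [hK]; positivity)
  have := Fintype.ofFinite K
  by_cases h : ringChar K = 2
  · exact FiniteField.isSquare_of_char_two h s
  rw [FiniteField.isSquare_iff h hs]
  rw [Nat.card_eq_fintype_card] at hK
  have hodd : Odd (p ^ e) := by
    have := FiniteField.odd_card_of_char_ne_two h
    rw [← Nat.odd_iff, hK] at this
    exact (Nat.odd_pow_iff two_ne_zero).mp this
  obtain ⟨k, hk⟩ := hodd
  have hc : Fintype.card K / 2 = 2 * k * (k + 1) := by
    rw [hK, hk]
    have : (2 * k + 1) ^ 2 = 2 * (2 * k * (k + 1)) + 1 := by ring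
    omega
  rw [hk] at h1 h2
  have h3 : s ^ (2 * k) = μ ^ 2 := by
    apply mul_right_cancel₀ hs
    rw [← pow_succ, h1, mul_comm]
  rw [hc, pow_mul, h3, ← pow_mul, ← h2, ← pow_succ]
  congr 1

variable [ExpChar K p]

/-- A permutation `x ↦ a * x * b` that fixes `classA` is given by upper triangular matrices and
scales lower left entries by an element of `𝔽_q`. -/
theorem triangular_of_smul_classA (hK : ∃ y : K, y ^ p ^ e ≠ y) {γ : Equiv.Perm SL(2, K)}
    {a b : Matrix (Fin 2) (Fin 2) K} (hγ : ∀ x, (γ x).1 = a * x.1 * b)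
    (hA : γ • classA K p e = classA K p e) :
    a 1 0 = 0 ∧ b 1 0 = 0 ∧ (a 1 1 * b 0 0) ^ p ^ e = a 1 1 * b 0 0 := by
  have hdet : a.det * b.det = 1 := by
    have := (γ 1).2
    rw [hγ, det_mul, det_mul] at this
    simpa using this
  have ha : a 0 0 * a 1 1 - a 0 1 * a 1 0 ≠ 0 := by
    rw [← det_fin_two]; exact left_ne_zero_of_mul_eq_one hdet
  have hb : b 0 0 * b 1 1 - b 0 1 * b 1 0 ≠ 0 := by
    rw [← det_fin_two]; exact right_ne_zero_of_mul_eq_one hdet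
  have hmem : ∀ B ∈ classA K p e, ∀ x ∈ B, ∀ y ∈ B,
      (γ x ∈ Omega K p e ∧ ∀ j, (γ x).1 1 j = (γ y).1 1 j) ∨
        (γ x ∉ Omega K p e ∧ ∀ i, (γ x).1 i 0 = (γ y).1 i 0) := by
    intro B hB x hx y hy
    have : γ • B ∈ classA K p e := hA ▸ Set.smul_mem_smul_set hB
    exact rows_or_cols_of_mem_classA this (Set.smul_mem_smul_set hx) (Set.smul_mem_smul_set hy)
  have entry : ∀ x : SL(2, K), ∀ i j, (γ x).1 i j =
      (a i 0 * x.1 0 0 + a i 1 * x.1 1 0) * b 0 j + (a i 0 * x.1 0 1 + a i 1 * x.1 1 1) * b 1 j := by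
    intro x i j
    rw [hγ]
    simp [Matrix.mul_apply, Fin.sum_univ_two]
  -- The two test elements of the block T·`lower z` differ by the matrix with rows (z, 1) and 0.
  -- Equal second rows of the images give a 1 0 • (z, 1)b = 0; equal first columns give (z * b 0 0 +
  -- b 1 0) times the first column of a equal to 0.
  have left : ∀ z : K, z ^ p ^ e = z →
      (γ (lower z) ∈ Omega K p e ∧ a 1 0 = 0) ∨
        (γ (lower z) ∉ Omega K p e ∧ z * b 0 0 + b 1 0 = 0) := by
    intro z hz
    have := hmem _ (Or.inl ⟨lower z, hz, rfl⟩) (lower z)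
      ⟨1, ⟨0, by simp [← Matrix.one_fin_two]⟩, by simp⟩ (upper 1 * lower z) ⟨_, upper_mem_T 1, rfl⟩
    refine this.imp (And.imp_right fun h => ?_) (And.imp_right fun h => ?_)
    · have h0 := h 0
      have h1 := h 1
      rw [entry, entry, Matrix.SpecialLinearGroup.coe_mul] at h0 h1
      simp at h0 h1
      grind
    · have h0 := h 0
      have h1 := h 1
      rw [entry, entry, Matrix.SpecialLinearGroup.coe_mul] at h0 h1
      simp at h0 h1
      grind
  have ha10 : a 1 0 = 0 := by
    by_contra h
    -- If a 1 0 ≠ 0, then z = 0 and z = 1 together kill the first column of b.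
    have h0 := left 0 (by simp [(expChar_pos K p).ne'])
    have h1 := left 1 (by simp)
    simp only [h, and_false, false_or] at h0 h1
    grind
  have hmul : (γ (lower 1)).1 1 0 = a 1 1 * (b 0 0 + b 1 0) := by
    rw [entry]
    simp [ha10]
    ring
  have hb10 : b 1 0 = 0 := by
    obtain ⟨z, hz⟩ := hK
    have hz0 : z ≠ 0 := by
      rintro rfl
      simp [(expChar_pos K p).ne'] at hz
    have := hmem _ (Or.inr ⟨lower z, hz, rfl⟩) (lower z)
      ⟨1, ⟨0, by simp [← Matrix.one_fin_two]⟩, by simp⟩ (lower z * upper 1) ⟨_, upper_mem_T 1, rfl⟩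
    -- Both alternatives equate the lower left entries of the images, which differ by a 1 1 * z * b
    -- 1 0.
    rcases this with ⟨-, h⟩ | ⟨-, h⟩
    · have h0 := h 0
      have h1 := h 1
      rw [entry, entry, Matrix.SpecialLinearGroup.coe_mul] at h0 h1
      simp [ha10] at h0 h1
      grind
    · have h0 := h 0
      have h1 := h 1
      rw [entry, entry, Matrix.SpecialLinearGroup.coe_mul] at h0 h1
      simp [ha10] at h0 h1
      grind
  refine ⟨ha10, hb10, ?_⟩
  rcases left 1 (by simp) with ⟨h, -⟩ | ⟨-, h⟩
  · change _ ^ _ = _ at h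
    rwa [hmul, hb10, add_zero] at h
  · grind

lemma coe_bar (h : SL(2, K)) : (bar K p e h).1 = h.1.map (iterateFrobenius K p e) := rfl

/-- A matrix all of whose conjugates are upper triangular is scalar. -/
lemma eq_scalar_of_conj_triangular {C : Matrix (Fin 2) (Fin 2) K}
    (h0 : C 1 0 = 0)
    (h1 : ((lower 1 : SL(2, K)).1 * C * (lower 1 : SL(2, K))⁻¹.1) 1 0 = 0)
    (h2 : ((lower 1 * upper 1 : SL(2, K)).1 * C * (lower 1 * upper 1 : SL(2, K))⁻¹.1) 1 0 = 0) :
    C = C 0 0 • (1 : Matrix (Fin 2) (Fin 2) K) := by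
  -- The hypotheses say that C preserves the lines spanned by (1, 0), (1, -1) and (2, -1), which are
  -- distinct in every characteristic.
  rw [_root_.mul_inv_rev] at h2
  simp [Matrix.mul_apply, Fin.sum_univ_two, adjugate_fin_two, vecMul, dotProduct] at h1 h2
  ext i j
  fin_cases i <;> fin_cases j <;> simp [h0] <;> grind

lemma vartheta_apply (h x : SL(2, K)) : vartheta K p e h x = h⁻¹ * x * bar K p e h := rfl

lemma vartheta_inv_apply (h x : SL(2, K)) :
    (vartheta K p e h)⁻¹ x = h * x * (bar K p e h)⁻¹ := rfl

lemma bar_lower_one : bar K p e (lower 1) = lower 1 := by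
  apply Subtype.ext
  rw [coe_bar]
  ext i j
  fin_cases i <;> fin_cases j <;> simp

lemma bar_upper_one : bar K p e (upper 1) = upper 1 := by
  apply Subtype.ext
  rw [coe_bar]
  ext i j
  fin_cases i <;> fin_cases j <;> simp

/-- If γ maps the class of h to that of h', then ϑ_{h'}⁻¹ γ ϑ_h fixes A; its matrices are a' = h' a
h⁻¹ and b' = φ(h) b φ(h')⁻¹. The unknown h' cancels in b'·φ(a'). -/
lemma exists_triangular_of_smul_piSq (hK : ∃ y : K, y ^ p ^ e ≠ y) {γ : Equiv.Perm SL(2, K)}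
    {a b : Matrix (Fin 2) (Fin 2) K} (hγ : ∀ x, (γ x).1 = a * x.1 * b)
    (hpi : γ • piSq K p e = piSq K p e) (h : SL(2, K)) :
    ∃ a' b' : Matrix (Fin 2) (Fin 2) K, a'.det = a.det ∧
      (bar K p e h).1 * (b * a.map (iterateFrobenius K p e)) * (bar K p e h)⁻¹.1 =
        b' * a'.map (iterateFrobenius K p e) ∧
      a' 1 0 = 0 ∧ b' 1 0 = 0 ∧ (a' 1 1 * b' 0 0) ^ p ^ e = a' 1 1 * b' 0 0 := by
  have : γ • vartheta K p e h • classA K p e ∈ piSq K p e := by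
    rw [← hpi]
    exact Set.smul_mem_smul_set ⟨h, rfl⟩
  obtain ⟨h', hh'⟩ := this
  refine ⟨h'.1 * a * h⁻¹.1, (bar K p e h).1 * b * (bar K p e h')⁻¹.1,
    by rw [det_mul, det_mul, h'.2, h⁻¹.2, one_mul, mul_one], ?_,
    triangular_of_smul_classA hK
      (γ := (vartheta K p e h')⁻¹ * γ * vartheta K p e h) (fun x => ?_) ?_⟩
  · have e1 : (h'.1 * a * h⁻¹.1).map (iterateFrobenius K p e) =
        (bar K p e h').1 * a.map (iterateFrobenius K p e) * (bar K p e h)⁻¹.1 := by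
      rw [Matrix.map_mul, Matrix.map_mul, ← map_inv]
      rfl
    have e2 : ∀ N, (bar K p e h')⁻¹.1 * ((bar K p e h').1 * N) = N := fun N => by
      rw [← Matrix.mul_assoc, ← Matrix.SpecialLinearGroup.coe_mul, inv_mul_cancel,
        Matrix.SpecialLinearGroup.coe_one, Matrix.one_mul]
    rw [e1]
    simp only [Matrix.mul_assoc, e2]
  · rw [Equiv.Perm.mul_apply, Equiv.Perm.mul_apply, vartheta_inv_apply, vartheta_apply]
    simp only [Matrix.SpecialLinearGroup.coe_mul]
    rw [hγ]
    simp only [Matrix.SpecialLinearGroup.coe_mul, Matrix.mul_assoc]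
  · rw [mul_smul, mul_smul, hh', inv_smul_smul]

lemma exists_scalar_of_smul_piSq [Fact p.Prime] (hK : Nat.card K = (p ^ e) ^ 2)
    {γ : Equiv.Perm SL(2, K)} {a b : Matrix (Fin 2) (Fin 2) K}
    (hγ : ∀ x, (γ x).1 = a * x.1 * b) (hpi : γ • piSq K p e = piSq K p e) :
    ∃ μ : K, b * a.map (iterateFrobenius K p e) = μ • (1 : Matrix (Fin 2) (Fin 2) K) ∧
      (a.det * μ) ^ p ^ e = a.det * μ := by
  set φ := iterateFrobenius K p e with hφ
  have hφ' : ∀ x, φ x = x ^ p ^ e := fun x => rfl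
  have key := exists_triangular_of_smul_piSq (exists_pow_ne hK) hγ hpi
  rw [← hφ] at key
  set C := b * a.map φ with hC
  have hCtri : ∀ h, ((bar K p e h).1 * C * (bar K p e h)⁻¹.1) 1 0 = 0 := fun h => by
    obtain ⟨a', b', -, h0, h1, h2, -⟩ := key h
    rw [h0, Matrix.mul_apply, Fin.sum_univ_two, h2, Matrix.map_apply, Matrix.map_apply, h1,
      map_zero, zero_mul, mul_zero, add_zero]
  have t0 := hCtri 1
  have t1 := hCtri (lower 1)
  have t2 := hCtri (lower 1 * upper 1)
  have ebar : bar K p e (lower 1 * upper 1) = lower 1 * upper 1 := by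
    rw [_root_.map_mul, bar_lower_one, bar_upper_one]
  rw [bar_lower_one] at t1
  rw [ebar] at t2
  have hCμ := eq_scalar_of_conj_triangular (by simpa using t0) t1 t2
  refine ⟨C 0 0, hCμ, ?_⟩
  set μ := C 0 0
  obtain ⟨a', b', e2, e1, h1, h2, h3⟩ := key 1
  rw [hCμ] at e1
  rw [← e2, det_fin_two, h1, mul_zero, sub_zero]
  have e3 := congrFun₂ e1 0 0
  rw [Matrix.mul_apply (M := b'), Fin.sum_univ_two, Matrix.map_apply, Matrix.map_apply, h1] at e3
  simp at e3
  rw [← hφ'] at h3 ⊢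
  have hqq : φ (φ (a' 0 0)) = a' 0 0 := by
    have : Finite K := Nat.finite_of_card_ne_zero
      (by rw [hK]; exact pow_ne_zero _ (pow_ne_zero _ (Fact.out : p.Prime).ne_zero))
    have := Fintype.ofFinite K
    rw [hφ', hφ', ← pow_mul, ← sq, ← hK, Nat.card_eq_fintype_card, FiniteField.pow_card]
  -- Here det a = a' 0 0 * a' 1 1 and μ = b' 0 0 * φ (a' 0 0), so det a * μ is a' 1 1 * b' 0 0 times
  -- the norm of a' 0 0.
  rw [e3]
  simp only [_root_.map_mul] at h3 ⊢
  rw [hqq]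
  linear_combination φ (a' 0 0) * a' 0 0 * h3

/-- A permutation `x ↦ a * x * b` that stabilizes `piSq` is, up to sign, some `ϑ_g`. -/
theorem eq_vartheta_of_smul_piSq [Fact p.Prime] (hK : Nat.card K = (p ^ e) ^ 2)
    {γ : Equiv.Perm SL(2, K)} {a b : Matrix (Fin 2) (Fin 2) K}
    (hγ : ∀ x, (γ x).1 = a * x.1 * b) (hpi : γ • piSq K p e = piSq K p e) :
    ∃ g : SL(2, K), γ = vartheta K p e g ∨ γ = vartheta K p e g * rho (-1) := by
  obtain ⟨μ, hCμ, hsμ⟩ := exists_scalar_of_smul_piSq hK hγ hpi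
  set φ := iterateFrobenius K p e with hφ
  have hφ' : ∀ x, φ x = x ^ p ^ e := fun x => rfl
  have hdet : a.det * b.det = 1 := by
    have := (γ 1).2
    rw [hγ, det_mul, det_mul] at this
    simpa using this
  have ha : a.det ≠ 0 := left_ne_zero_of_mul_eq_one hdet
  rw [← hφ'] at hsμ
  have hμ2 : b.det * φ a.det = μ ^ 2 := by
    have := congrArg det hCμ
    rw [det_mul, det_smul] at this
    rw [RingHom.map_det]
    simpa using this
  generalize hs : a.det = s at *
  have hsq : φ s = s * μ ^ 2 := by linear_combination s * hμ2 - φ s * hdet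
  have hμ0 : μ ≠ 0 := by
    rintro h
    rw [h] at hsq
    simp at hsq
    exact ha hsq
  have hμq : φ μ * μ = 1 := by
    rw [_root_.map_mul, hsq] at hsμ
    have : s * μ ≠ 0 := mul_ne_zero ha hμ0
    apply mul_left_cancel₀ this
    linear_combination hsμ
  obtain ⟨t, ht⟩ := isSquare_of_pow_eq hK ha hsq hμq
  have ht0 : t ≠ 0 := by
    rintro rfl
    simp [ha] at ht
  have hφt : φ t ≠ 0 := by simpa using ht0
  let g : SL(2, K) := ⟨t⁻¹ • a, by
    rw [det_smul, hs, ht, Fintype.card_fin]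
    field_simp⟩
  have hgb : t • b * (bar K p e g).1 = (t * (φ t)⁻¹ * μ) • (1 : Matrix (Fin 2) (Fin 2) K) := by
    have : (bar K p e g).1 = (φ t)⁻¹ • a.map φ := by
      rw [coe_bar]
      ext i j
      simp [g, hφ]
    rw [this, smul_mul_smul_comm, hCμ, smul_smul]
  -- Rescaling a by the root t of its determinant leaves only this sign undetermined; it decides
  -- whether ρ_{-1} is needed.
  have hε : (t * (φ t)⁻¹ * μ) ^ 2 = 1 := by
    rw [ht, _root_.map_mul] at hsq
    field_simp
    linear_combination -hsq
  have hγg : ∀ x, (γ x).1 * (bar K p e g).1 = (t * (φ t)⁻¹ * μ) • (g * x).1 := fun x => by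
    have : a * x.1 * b = g.1 * x.1 * (t • b) := by
      simp only [g, smul_mul_assoc, mul_smul_comm, smul_smul]
      rw [mul_inv_cancel₀ ht0, one_smul]
    rw [hγ, this, Matrix.mul_assoc, hgb, mul_smul_comm, mul_one, Matrix.SpecialLinearGroup.coe_mul]
  refine ⟨g⁻¹, ?_⟩
  rcases (sq_eq_sq_iff_eq_or_eq_neg.mp (hε.trans (one_pow 2).symm)) with h | h
  · left
    ext1 x
    rw [vartheta_apply, map_inv, eq_mul_inv_iff_mul_eq, inv_inv]
    apply Subtype.ext
    rw [Matrix.SpecialLinearGroup.coe_mul, hγg, h, one_smul]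
  · right
    ext1 x
    rw [Equiv.Perm.mul_apply, vartheta_apply, map_inv, eq_mul_inv_iff_mul_eq, inv_inv]
    apply Subtype.ext
    rw [Matrix.SpecialLinearGroup.coe_mul, hγg, h]
    simp [rho]

end stabilizer

/-! ### The action of PΣL(2,K) and the determination of Γ -/

section group

variable {K : Type*} [Field K] {p e : ℕ}

lemma toPerm_fieldAut_apply (σ : K ≃+* K) (x : SL(2, K)) :
    MulAut.toPerm SL(2, K) (fieldAut K σ) x = fieldAut K σ x := rfl

lemma rho_apply (h x : SL(2, K)) : rho h x = x * h := rfl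

lemma exists_eq_rho_mul_of_mem_autRight {γ : Equiv.Perm SL(2, K)} (hγ : γ ∈ autRight K) :
    ∃ (h : SL(2, K)) (α : MulAut SL(2, K)), γ = rho h * MulAut.toPerm _ α := by
  have : γ ∈ (autRight K : Set _) := hγ
  rw [autRight, Subgroup.coe_mul_of_right_le_normalizer_left _ _
    (autRight_isInternalSemidirect K).le_normalizer] at this
  obtain ⟨_, ⟨h, rfl⟩, _, ⟨α, rfl⟩, rfl⟩ := this
  exact ⟨h, α, rfl⟩

lemma mem_center_iff_eq_one_or_neg_one {h : SL(2, K)} :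
    h ∈ Subgroup.center SL(2, K) ↔ h = 1 ∨ h = -1 := by
  rw [Matrix.SpecialLinearGroup.mem_center_iff]
  constructor
  · rintro ⟨r, hr, hh⟩
    rw [Fintype.card_fin] at hr
    rcases sq_eq_sq_iff_eq_or_eq_neg.mp (hr.trans (one_pow 2).symm) with rfl | rfl
    · left
      apply Subtype.ext
      rw [← hh]
      simp
    · right
      apply Subtype.ext
      rw [← hh]
      simp [← smul_one_eq_diagonal]
  · rintro (rfl | rfl)
    · exact ⟨1, by simp, by simp⟩
    · exact ⟨-1, by simp, by simp [← smul_one_eq_diagonal]⟩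

lemma center_eq_zpowers : Subgroup.center SL(2, K) = Subgroup.zpowers (-1) := by
  ext h
  rw [mem_center_iff_eq_one_or_neg_one]
  constructor
  · rintro (rfl | rfl)
    · exact one_mem _
    · exact Subgroup.mem_zpowers _
  · rintro ⟨n, rfl⟩
    exact Int.even_or_odd n |>.imp (fun h => h.neg_one_zpow) (fun h => h.neg_one_zpow)

lemma rho_neg_one_sq : rho (-1 : SL(2, K)) * rho (-1) = 1 := by
  ext1 x
  simp [rho_apply]

lemma mem_zpowers_rho_iff {γ : Equiv.Perm SL(2, K)} :
    γ ∈ Subgroup.zpowers (rho (-1 : SL(2, K))) ↔ γ = 1 ∨ γ = rho (-1) := by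
  constructor
  · rintro ⟨n, rfl⟩
    have hsq : rho (-1 : SL(2, K)) ^ 2 = 1 := (sq _).trans rho_neg_one_sq
    rcases Int.even_or_odd' n with ⟨k, rfl | rfl⟩
    · left
      simp [_root_.zpow_mul, hsq]
    · right
      simp [_root_.zpow_add, _root_.zpow_mul, hsq]
  · rintro (rfl | rfl)
    · exact one_mem _
    · exact Subgroup.mem_zpowers _

/-- Conjugation preserves traces, and every y in K is the trace of a companion matrix in SL(2,K); so
σ fixes y. -/
lemma eq_one_and_mem_center_of_conj {σ : K ≃+* K} {g : SL(2, K)}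
    (h : ∀ x, g * fieldAut K σ x * g⁻¹ = x) : σ = 1 ∧ g ∈ Subgroup.center SL(2, K) := by
  have hσ : σ = 1 := by
    ext y
    let x : SL(2, K) := ⟨!![y, -1; 1, 0], by simp [det_fin_two]⟩
    have h1 : g * fieldAut K σ x = x * g := mul_inv_eq_iff_eq_mul.mp (h x)
    have h2 : fieldAut K σ x = g⁻¹ * (x * g) := by rw [← h1]; simp
    have h3 := congrArg (fun m : SL(2, K) => m.1.trace) h2
    rw [Matrix.SpecialLinearGroup.coe_mul, trace_mul_comm, ← Matrix.SpecialLinearGroup.coe_mul,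
      mul_assoc, mul_inv_cancel, mul_one, coe_fieldAut] at h3
    simpa [x, trace_fin_two] using h3
  subst hσ
  refine ⟨rfl, Subgroup.mem_center_iff.mpr fun x => ?_⟩
  have := h x
  rw [map_one, MulAut.one_apply, mul_inv_eq_iff_eq_mul] at this
  exact this.symm

lemma smul_classA [Finite K] {γ : Equiv.Perm SL(2, K)} (τ : MulAut SL(2, K))
    (hT : ∀ t, τ t ∈ T K ↔ t ∈ T K) (hΩ : ∀ x, γ x ∈ Omega K p e ↔ x ∈ Omega K p e)
    (hl : ∀ t x, γ (t * x) = τ t * γ x) (hr : ∀ x t, γ (x * t) = γ x * τ t) :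
    γ • classA K p e = classA K p e := by
  -- By finiteness it suffices that γ maps the class into itself.
  have hfin : (classA K p e).Finite := Set.toFinite _
  refine (MulAction.mem_stabilizer_set' hfin).mpr ?_
  rintro _ (⟨g, hg, rfl⟩ | ⟨g, hg, rfl⟩)
  · refine Or.inl ⟨γ g, (hΩ g).mpr hg, ?_⟩
    ext y
    rw [Set.mem_smul_set]
    constructor
    · rintro ⟨_, ⟨t, ht, rfl⟩, rfl⟩
      exact ⟨τ t, (hT t).mpr ht, hl t g⟩
    · rintro ⟨t, ht, rfl⟩
      refine ⟨τ.symm t * g, ⟨_, (hT _).mp (by rwa [MulEquiv.apply_symm_apply]), rfl⟩, ?_⟩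
      exact (hl _ _).trans (by rw [MulEquiv.apply_symm_apply])
  · refine Or.inr ⟨γ g, fun h => hg ((hΩ g).mp h), ?_⟩
    ext y
    rw [Set.mem_smul_set]
    constructor
    · rintro ⟨_, ⟨t, ht, rfl⟩, rfl⟩
      exact ⟨τ t, (hT t).mpr ht, hr g t⟩
    · rintro ⟨t, ht, rfl⟩
      refine ⟨g * τ.symm t, ⟨_, (hT _).mp (by rwa [MulEquiv.apply_symm_apply]), rfl⟩, ?_⟩
      exact (hr _ _).trans (by rw [MulEquiv.apply_symm_apply])

variable [ExpChar K p]

variable (K p e) in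
/-- The homomorphism `h ↦ ϑ_{h⁻¹}`. -/
def varthetaHom : SL(2, K) →* Equiv.Perm SL(2, K) where
  -- The inverse is needed because ϑ_h ∘ ϑ_g = ϑ_{gh}.
  toFun h := vartheta K p e h⁻¹
  map_one' := by ext1 x; simp [vartheta_apply]
  map_mul' g h := by
    ext1 x
    simp [vartheta_apply, mul_assoc]

lemma varthetaHom_apply (h x : SL(2, K)) : varthetaHom K p e h x = h * x * (bar K p e h)⁻¹ := by
  change (h⁻¹)⁻¹ * x * bar K p e h⁻¹ = _
  rw [inv_inv, map_inv]

lemma vartheta_eq (h : SL(2, K)) : vartheta K p e h = varthetaHom K p e h⁻¹ := by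
  change _ = vartheta K p e _
  rw [inv_inv]

lemma range_varthetaHom : (varthetaHom K p e).range = varthetaGroup K p e := by
  apply le_antisymm
  · rintro _ ⟨h, rfl⟩
    exact Subgroup.subset_closure ⟨h⁻¹, rfl⟩
  · rw [varthetaGroup, Subgroup.closure_le]
    rintro _ ⟨h, rfl⟩
    exact ⟨h⁻¹, (vartheta_eq h).symm⟩

lemma bar_of_mem_center {h : SL(2, K)} (hh : h ∈ Subgroup.center SL(2, K)) :
    bar K p e h = h := by
  rcases mem_center_iff_eq_one_or_neg_one.mp hh with rfl | rfl
  · exact map_one _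
  · apply Subtype.ext
    rw [coe_bar]
    ext i j
    fin_cases i <;> fin_cases j <;> simp

lemma center_le_ker_varthetaHom : Subgroup.center SL(2, K) ≤ (varthetaHom K p e).ker := by
  intro h hh
  rw [MonoidHom.mem_ker]
  ext1 x
  rw [varthetaHom_apply, bar_of_mem_center hh, ← Subgroup.mem_center_iff.mp hh, mul_inv_cancel_right]
  rfl

lemma fieldAut_bar (σ : K ≃+* K) (x : SL(2, K)) :
    fieldAut K σ (bar K p e x) = bar K p e (fieldAut K σ x) := by
  apply Subtype.ext
  rw [coe_fieldAut, coe_bar, coe_bar, coe_fieldAut]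
  ext i j
  simp [iterateFrobenius_def]

lemma fieldAut_conj_varthetaHom (σ : K ≃+* K) (h : SL(2, K)) :
    MulAut.toPerm _ (fieldAut K σ) * varthetaHom K p e h * (MulAut.toPerm _ (fieldAut K σ))⁻¹ =
      varthetaHom K p e (fieldAut K σ h) := by
  rw [mul_inv_eq_iff_eq_mul]
  ext1 x
  simp only [Equiv.Perm.mul_apply, varthetaHom_apply, toPerm_fieldAut_apply, _root_.map_mul, map_inv,
    fieldAut_bar]

lemma varthetaHom_mul_rho_neg_one (h : SL(2, K)) :
    varthetaHom K p e h * rho (-1) = rho (-1) * varthetaHom K p e h := by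
  ext1 x
  simp [varthetaHom_apply, rho_apply]

lemma fieldAut_neg_one (σ : K ≃+* K) : fieldAut K σ (-1) = -1 := by
  apply Subtype.ext
  rw [coe_fieldAut]
  ext i j
  fin_cases i <;> fin_cases j <;> simp

lemma fieldAut_mul_rho_neg_one (σ : K ≃+* K) :
    MulAut.toPerm _ (fieldAut K σ) * rho (-1) = rho (-1) * MulAut.toPerm _ (fieldAut K σ) := by
  ext1 x
  simp only [Equiv.Perm.mul_apply, toPerm_fieldAut_apply, rho_apply, _root_.map_mul,
    fieldAut_neg_one]

variable (K p e) in
/-- The homomorphism `PSL(2,K) → Sym(SL(2,K))` induced by `h ↦ ϑ_{h⁻¹}`. -/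
def varthetaPSL : PSL(2, K) →* Equiv.Perm SL(2, K) :=
  QuotientGroup.lift _ (varthetaHom K p e) center_le_ker_varthetaHom

lemma range_varthetaPSL : (varthetaPSL K p e).range = varthetaGroup K p e := by
  rw [← range_varthetaHom]
  ext γ
  constructor
  · rintro ⟨⟨h⟩, rfl⟩
    exact ⟨h, rfl⟩
  · rintro ⟨h, rfl⟩
    exact ⟨(h : PSL(2, K)), rfl⟩

lemma varthetaPSL_mk (h : SL(2, K)) : varthetaPSL K p e (h : PSL(2, K)) = varthetaHom K p e h :=
  rfl

lemma fieldAutPSL_mk (σ : K ≃+* K) (h : SL(2, K)) :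
    fieldAutPSL K σ (h : PSL(2, K)) = (fieldAut K σ h : SL(2, K)) := rfl

lemma varthetaPSL_fieldAutPSL (σ : K ≃+* K) (n : PSL(2, K)) :
    varthetaPSL K p e (fieldAutPSL K σ n) =
      MulAut.toPerm _ (fieldAut K σ) * varthetaPSL K p e n *
        (MulAut.toPerm _ (fieldAut K σ))⁻¹ := by
  induction n using QuotientGroup.induction_on with
  | H h => rw [fieldAutPSL_mk, varthetaPSL_mk, varthetaPSL_mk, fieldAut_conj_varthetaHom]

variable (K p e) in
/-- The action of `PΣL(2,K)` on `SL(2,K)` by permutations `ϑ_h` and field automorphisms. -/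
def pSigmaLHom : PSigmaL K →* Equiv.Perm SL(2, K) :=
  SemidirectProduct.lift (varthetaPSL K p e) ((MulAut.toPerm SL(2, K)).comp (fieldAut K))
    fun σ => MonoidHom.ext fun n => varthetaPSL_fieldAutPSL σ n

lemma pSigmaLHom_mk (h : SL(2, K)) (σ : K ≃+* K) :
    pSigmaLHom K p e ⟨(h : PSL(2, K)), σ⟩ =
      varthetaHom K p e h * MulAut.toPerm _ (fieldAut K σ) := rfl

lemma range_pSigmaLHom :
    (pSigmaLHom K p e).range = varthetaGroup K p e ⊔ fieldAutPerms K := by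
  apply le_antisymm
  · rintro _ ⟨⟨n, σ⟩, rfl⟩
    exact mul_mem (Subgroup.mem_sup_left (range_varthetaPSL (K := K) (p := p) (e := e) ▸ ⟨n, rfl⟩))
      (Subgroup.mem_sup_right ⟨σ, rfl⟩)
  · rw [sup_le_iff, ← range_varthetaPSL]
    constructor
    · rintro _ ⟨n, rfl⟩
      exact ⟨SemidirectProduct.inl n, SemidirectProduct.lift_inl _ _ _ _⟩
    · rintro _ ⟨σ, rfl⟩
      exact ⟨SemidirectProduct.inr σ, SemidirectProduct.lift_inr _ _ _ _⟩

/-- This yields at once faithfulness and trivial intersection with ⟨ρ_{-1}⟩. Evaluation at 1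
expresses φ(h)⁻¹ as h⁻¹c; after cancelling c, σ followed by conjugation by h is the identity. -/
lemma eq_one_of_pSigmaLHom_mem_zpowers {x : PSigmaL K}
    (hx : pSigmaLHom K p e x ∈ Subgroup.zpowers (rho (-1 : SL(2, K)))) : x = 1 := by
  obtain ⟨⟨h⟩, σ⟩ := x
  change pSigmaLHom K p e ⟨(h : PSL(2, K)), σ⟩ ∈ _ at hx
  change (⟨(h : PSL(2, K)), σ⟩ : PSigmaL K) = 1
  rw [pSigmaLHom_mk] at hx
  obtain ⟨c, hc, hall⟩ : ∃ c : SL(2, K), (c = 1 ∨ c = -1) ∧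
      ∀ x, h * fieldAut K σ x * (bar K p e h)⁻¹ = x * c := by
    rcases mem_zpowers_rho_iff.mp hx with h | h
    · exact ⟨1, Or.inl rfl, fun x => by
        have := congrArg (fun γ : Equiv.Perm SL(2, K) => γ x) h
        simpa [varthetaHom_apply, toPerm_fieldAut_apply] using this⟩
    · exact ⟨-1, Or.inr rfl, fun x => by
        have := congrArg (fun γ : Equiv.Perm SL(2, K) => γ x) h
        simpa only [Equiv.Perm.mul_apply, varthetaHom_apply, toPerm_fieldAut_apply, rho_apply]
          using this⟩
  have hbar : (bar K p e h)⁻¹ = h⁻¹ * c := by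
    have := hall 1
    rw [map_one, mul_one, one_mul] at this
    rw [← this, inv_mul_cancel_left]
  obtain ⟨rfl, hh⟩ := eq_one_and_mem_center_of_conj (σ := σ) (g := h) (fun x => by
    have := hall x
    rwa [hbar, ← mul_assoc, mul_left_inj] at this)
  have : (h : PSL(2, K)) = 1 := (QuotientGroup.eq_one_iff h).mpr hh
  rw [this]
  rfl

lemma pSigmaLHom_injective : Function.Injective (pSigmaLHom K p e) :=
  (injective_iff_map_eq_one _).mpr fun x hx =>
    eq_one_of_pSigmaLHom_mem_zpowers (p := p) (e := e) (by rw [hx]; exact one_mem _)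

lemma pSigmaLHom_commute (x : PSigmaL K) (z : Subgroup.zpowers (rho (-1 : SL(2, K)))) :
    Commute (pSigmaLHom K p e x) ((Subgroup.zpowers (rho (-1 : SL(2, K)))).subtype z) := by
  obtain ⟨⟨h⟩, σ⟩ := x
  change Commute (varthetaHom K p e h * MulAut.toPerm _ (fieldAut K σ)) z.1
  obtain ⟨z, n, rfl⟩ := z
  refine Commute.zpow_right (Commute.mul_left ?_ ?_) n
  · exact varthetaHom_mul_rho_neg_one h
  · exact fieldAut_mul_rho_neg_one σ

/-! ### The stabilizer -/

variable [Finite K]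

lemma mem_stabilizer_piSq {γ : Equiv.Perm SL(2, K)} (hA : γ • classA K p e = classA K p e)
    (hγ : ∀ h, ∃ h', γ * vartheta K p e h = vartheta K p e h' * γ) :
    γ ∈ MulAction.stabilizer (Equiv.Perm SL(2, K)) (piSq K p e) := by
  refine (MulAction.mem_stabilizer_set' (Set.toFinite _)).mpr ?_
  rintro _ ⟨h, rfl⟩
  obtain ⟨h', hh⟩ := hγ h
  exact ⟨h', by rw [smul_smul, hh, mul_smul, hA]⟩

lemma rho_neg_one_mem_stabilizer :
    rho (-1 : SL(2, K)) ∈ MulAction.stabilizer (Equiv.Perm SL(2, K)) (piSq K p e) := by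
  refine mem_stabilizer_piSq (smul_classA 1 (fun t => Iff.rfl) (fun x => ?_) (fun t x => ?_)
    (fun x t => ?_)) (fun h => ⟨h, ?_⟩)
  · have h1 : (-1 : K) ^ p ^ e = -1 := by
      rw [← iterateFrobenius_def p e, map_neg, map_one]
    change (rho (-1) x).1 1 0 ^ p ^ e = (rho (-1) x).1 1 0 ↔ x.1 1 0 ^ p ^ e = x.1 1 0
    have h2 : (rho (-1) x).1 1 0 = -1 * x.1 1 0 := by simp [rho_apply]
    rw [h2, mul_pow, h1, mul_right_inj' (by simp)]
  · simp [rho_apply]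
  · simp [rho_apply]
  · rw [vartheta_eq, varthetaHom_mul_rho_neg_one]

lemma fieldAutPerms_le_stabilizer :
    fieldAutPerms K ≤ MulAction.stabilizer (Equiv.Perm SL(2, K)) (piSq K p e) := by
  rintro _ ⟨σ, rfl⟩
  change MulAut.toPerm _ (fieldAut K σ) ∈ _
  refine mem_stabilizer_piSq (smul_classA (fieldAut K σ) (fun t => ?_) (fun x => ?_)
    (fun t x => _root_.map_mul (fieldAut K σ) t x) (fun x t => _root_.map_mul (fieldAut K σ) x t))
    (fun h => ⟨fieldAut K σ h, ?_⟩)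
  · constructor
    · rintro ⟨x, hx⟩
      refine ⟨σ.symm x, ?_⟩
      ext i j
      apply σ.injective
      have := congrFun₂ hx i j
      rw [coe_fieldAut, Matrix.map_apply] at this
      rw [this]
      fin_cases i <;> fin_cases j <;> simp
    · rintro ⟨x, hx⟩
      refine ⟨σ x, ?_⟩
      rw [coe_fieldAut, hx]
      ext i j
      fin_cases i <;> fin_cases j <;> simp
  · change (fieldAut K σ x).1 1 0 ^ p ^ e = (fieldAut K σ x).1 1 0 ↔ x.1 1 0 ^ p ^ e = x.1 1 0
    rw [coe_fieldAut, Matrix.map_apply, ← map_pow, σ.injective.eq_iff]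
  · rw [vartheta_eq, vartheta_eq, ← map_inv, ← fieldAut_conj_varthetaHom, inv_mul_cancel_right]

lemma vartheta_mem_stabilizer (h : SL(2, K)) :
    vartheta K p e h ∈ MulAction.stabilizer (Equiv.Perm SL(2, K)) (piSq K p e) := by
  refine (MulAction.mem_stabilizer_set' (Set.toFinite _)).mpr ?_
  rintro _ ⟨g, rfl⟩
  refine ⟨g * h, ?_⟩
  rw [smul_smul, vartheta_eq, vartheta_eq, vartheta_eq, ← _root_.map_mul, _root_.mul_inv_rev]

lemma varthetaGroup_le_stabGamma : varthetaGroup K p e ≤ stabGamma K p e := by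
  rw [varthetaGroup, Subgroup.closure_le]
  rintro _ ⟨h, rfl⟩
  refine ⟨?_, vartheta_mem_stabilizer h⟩
  have : vartheta K p e h = rho (h⁻¹ * bar K p e h) * MulAut.toPerm _ (MulAut.conj h⁻¹) := by
    ext1 x
    change h⁻¹ * x * bar K p e h = h⁻¹ * x * (h⁻¹)⁻¹ * (h⁻¹ * bar K p e h)
    group
  rw [this]
  exact mul_mem (Subgroup.mem_sup_left ⟨_, rfl⟩) (Subgroup.mem_sup_right ⟨_, rfl⟩)

lemma fieldAutPerms_le_stabGamma : fieldAutPerms K ≤ stabGamma K p e := by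
  refine le_inf ?_ fieldAutPerms_le_stabilizer
  rintro _ ⟨σ, rfl⟩
  exact Subgroup.mem_sup_right ⟨_, rfl⟩

lemma zpowers_rho_le_stabGamma : Subgroup.zpowers (rho (-1)) ≤ stabGamma K p e := by
  rw [Subgroup.zpowers_le]
  exact ⟨Subgroup.mem_sup_left ⟨_, rfl⟩, rho_neg_one_mem_stabilizer⟩

/-- Composing ρ_h α with the inverse of the field automorphism belonging to α leaves x ↦ a x (a⁻¹h),
still in the stabilizer, to which `eq_vartheta_of_smul_piSq` applies. -/
theorem stabGamma_le [Fact p.Prime] [CharP K p] (hK : Nat.card K = (p ^ e) ^ 2) :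
    stabGamma K p e ≤
      (varthetaGroup K p e ⊔ fieldAutPerms K) ⊔ Subgroup.zpowers (rho (-1 : SL(2, K))) := by
  rintro γ ⟨hγ, hst⟩
  obtain ⟨h, α, rfl⟩ := exists_eq_rho_mul_of_mem_autRight hγ
  obtain ⟨σ, a, ha, hα⟩ := exists_semilinear_of_mulAut p α
  have hσ : MulAut.toPerm _ (fieldAut K σ) ∈ fieldAutPerms K := ⟨σ, rfl⟩
  have hst' := (MulAction.stabilizer (Equiv.Perm SL(2, K)) (piSq K p e)).mul_mem hst (inv_mem (fieldAutPerms_le_stabilizer (p := p) (e := e) hσ))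
  obtain ⟨g, hg⟩ := eq_vartheta_of_smul_piSq (a := a) (b := a⁻¹ * h.1) hK (fun x => by
    have hx := hα (fieldAut K σ⁻¹ x)
    have hσσ : fieldAut K σ (fieldAut K σ⁻¹ x) = x := by rw [map_inv, MulAut.apply_inv_self]
    rw [hσσ] at hx
    rw [← map_inv, ← map_inv]
    change (α (fieldAut K σ⁻¹ x) * h).1 = _
    rw [← Matrix.mul_assoc, ← hx, Matrix.mul_nonsing_inv_cancel_right _ _ ha.isUnit]
    rfl) hst'
  have hmem : rho h * MulAut.toPerm _ α * (MulAut.toPerm _ (fieldAut K σ))⁻¹ ∈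
      (varthetaGroup K p e ⊔ fieldAutPerms K) ⊔ Subgroup.zpowers (rho (-1 : SL(2, K))) := by
    have h1 : vartheta K p e g ∈ varthetaGroup K p e := Subgroup.subset_closure ⟨g, rfl⟩
    rcases hg with hg | hg
    · rw [hg]
      exact Subgroup.mem_sup_left (Subgroup.mem_sup_left h1)
    · rw [hg]
      exact mul_mem (Subgroup.mem_sup_left (Subgroup.mem_sup_left h1))
        (Subgroup.mem_sup_right (Subgroup.mem_zpowers _))
  have := mul_mem hmem (Subgroup.mem_sup_left (Subgroup.mem_sup_right hσ))
  rwa [inv_mul_cancel_right] at this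

end group

/-! ### Orders of the groups involved -/

section card

variable {K : Type*} [Field K] {p e : ℕ}

/-- The order of the group `SL(2,K)` over a finite field `K`. -/
theorem card_SL_two [Finite K] :
    Nat.card SL(2, K) = (Nat.card K ^ 2 - 1) * Nat.card K := by
  have := Fintype.ofFinite K
  let f : GL (Fin 2) K →* Kˣ := Matrix.GeneralLinearGroup.det
  have hsurj : Function.Surjective f := fun u => by
    refine ⟨Matrix.GeneralLinearGroup.mkOfDetNeZero !![(u : K), 0; 0, 1]
      (by simp [Matrix.det_fin_two]), ?_⟩
    ext
    simp [f, Matrix.GeneralLinearGroup.mkOfDetNeZero, Matrix.det_fin_two]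
  have h1 : Nat.card SL(2, K) = Nat.card f.ker := by
    have hr : (f.ker : Set (GL (Fin 2) K)) =
        Set.range (Matrix.SpecialLinearGroup.toGL : SL(2, K) → GL (Fin 2) K) := by
      rw [Matrix.SpecialLinearGroup.range_toGL]
      rfl
    exact Nat.card_congr
      ((Equiv.ofInjective _ Matrix.SpecialLinearGroup.toGL_injective).trans
        (Equiv.setCongr hr.symm))
  have h2 := Subgroup.card_eq_card_quotient_mul_card_subgroup f.ker
  rw [Nat.card_congr (QuotientGroup.quotientKerEquivOfSurjective f hsurj).toEquiv, ← h1,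
    Matrix.card_GL_field, Nat.card_units, Fin.prod_univ_two] at h2
  simp only [Fin.val_zero, Fin.val_one, pow_zero, pow_one, ← Nat.card_eq_fintype_card] at h2
  have hpos : 0 < Nat.card K - 1 := Nat.sub_pos_of_lt Finite.one_lt_card
  apply Nat.eq_of_mul_eq_mul_left hpos
  rw [← h2, sq (Nat.card K), ← Nat.sub_one_mul]
  ring

/-- The order of the automorphism group of a field with `p ^ n` elements. -/
theorem card_ringAut [Fact p.Prime] [CharP K p] {n : ℕ} (hK : Nat.card K = p ^ n) :
    Nat.card (K ≃+* K) = n := by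
  have hp : p.Prime := Fact.out
  have : Finite K := Nat.finite_of_card_ne_zero (by rw [hK]; exact pow_ne_zero _ hp.ne_zero)
  let := ZMod.algebra K p
  -- Every ring automorphism is linear over the prime field, so Galois theory counts them.
  have h1 : Nat.card (K ≃+* K) = Nat.card (K ≃ₐ[ZMod p] K) := Nat.card_congr
    { toFun := fun σ => AlgEquiv.ofRingEquiv (f := σ) fun x =>
        RingHom.congr_fun (Subsingleton.elim
          ((σ : K →+* K).comp (algebraMap (ZMod p) K)) (algebraMap (ZMod p) K)) x
      invFun := fun σ => σ.toRingEquiv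
      left_inv := fun σ => rfl
      right_inv := fun σ => rfl }
  rw [h1, IsGalois.card_aut_eq_finrank]
  apply Nat.pow_right_injective hp.two_le
  dsimp only
  rw [← hK, Module.natCard_eq_pow_finrank (K := ZMod p) (V := K), Nat.card_zmod]

lemma neg_one_eq_one_of_two [CharP K 2] : (-1 : SL(2, K)) = 1 := by
  apply Subtype.ext
  rw [Matrix.SpecialLinearGroup.coe_neg]
  ext i j
  rw [Matrix.neg_apply, CharTwo.neg_eq]

lemma neg_one_ne_one_of_ne_two [CharP K p] (hp : p ≠ 2) : (-1 : SL(2, K)) ≠ 1 := fun h => by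
  have h1 := congrArg (fun m : SL(2, K) => m.1 0 0) h
  simp at h1
  have := neg_one_eq_one_iff.mp h1
  exact hp (ringChar.eq K p ▸ this)

lemma rho_one : rho (1 : SL(2, K)) = 1 := by
  ext1 x
  simp [rho_apply]

lemma zpowers_rho_eq_bot [CharP K 2] : Subgroup.zpowers (rho (-1 : SL(2, K))) = ⊥ := by
  rw [neg_one_eq_one_of_two, rho_one, Subgroup.zpowers_one_eq_bot]

lemma orderOf_rho_neg_one [CharP K p] (hp : p ≠ 2) : orderOf (rho (-1 : SL(2, K))) = 2 := by
  refine orderOf_eq_prime (by rw [sq, rho_neg_one_sq]) fun h =>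
    neg_one_ne_one_of_ne_two (K := K) hp ?_
  have := congrArg (fun γ : Equiv.Perm SL(2, K) => γ 1) h
  simpa only [rho_apply, one_mul, Equiv.Perm.one_apply] using this

/-- The factor lost in passing from SL to PSL is regained from ⟨ρ_{-1}⟩, so #Γ = 2e · #SL(2,K) for
every p. -/
lemma card_zpowers_rho [CharP K p] :
    Nat.card (Subgroup.zpowers (rho (-1 : SL(2, K)))) = Nat.card (Subgroup.center SL(2, K)) := by
  rw [center_eq_zpowers]
  by_cases hp : p = 2
  · subst hp
    rw [zpowers_rho_eq_bot, neg_one_eq_one_of_two, Subgroup.zpowers_one_eq_bot]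
    simp
  · rw [Nat.card_zpowers, Nat.card_zpowers, orderOf_rho_neg_one hp,
      orderOf_eq_prime (p := 2) neg_one_sq (neg_one_ne_one_of_ne_two hp)]

end card

/-! ### Product decompositions, isomorphism type and order of Γ -/

section main

variable {K : Type*} [Field K] {p e : ℕ} [ExpChar K p]

theorem isInternalSemidirect_varthetaGroup :
    IsInternalSemidirect (varthetaGroup K p e ⊔ fieldAutPerms K)
      (varthetaGroup K p e) (fieldAutPerms K) where
  sup_eq := rfl
  le_normalizer := by
    have key : ∀ σ : K ≃+* K, ∀ γ ∈ varthetaGroup K p e,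
        MulAut.toPerm _ (fieldAut K σ) * γ * (MulAut.toPerm _ (fieldAut K σ))⁻¹ ∈
          varthetaGroup K p e := by
      intro σ γ hγ
      rw [← range_varthetaHom] at hγ ⊢
      obtain ⟨h, rfl⟩ := hγ
      exact ⟨_, (fieldAut_conj_varthetaHom σ h).symm⟩
    rintro _ ⟨σ, rfl⟩
    rw [Subgroup.mem_normalizer_iff]
    refine fun γ => ⟨key σ γ, fun h => ?_⟩
    have h2 := key σ⁻¹ _ h
    rw [map_inv, map_inv] at h2
    convert h2 using 1
    change _ = _ * (MulAut.toPerm _ (fieldAut K σ) * γ * (MulAut.toPerm _ (fieldAut K σ))⁻¹) * _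
    group
  disjoint := by
    rw [← range_varthetaPSL, Subgroup.disjoint_def]
    rintro _ ⟨n, rfl⟩ ⟨σ, hσ⟩
    -- A common element has preimages in both factors of PΣL(2,K); injectivity identifies them.
    have : pSigmaLHom K p e (SemidirectProduct.inr σ) =
        pSigmaLHom K p e (SemidirectProduct.inl n) :=
      (SemidirectProduct.lift_inr _ _ _ _).trans
        (hσ.trans (SemidirectProduct.lift_inl _ _ _ _).symm)
    have := congrArg SemidirectProduct.left (pSigmaLHom_injective this)
    rw [SemidirectProduct.left_inr, SemidirectProduct.left_inl] at this
    rw [← this, map_one]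

theorem isInternalDirect_stabGamma [Fact p.Prime] [CharP K p] (hK : Nat.card K = (p ^ e) ^ 2) :
    IsInternalDirect (stabGamma K p e) (varthetaGroup K p e ⊔ fieldAutPerms K)
      (Subgroup.zpowers (rho (-1 : SL(2, K)))) where
  sup_eq := by
    have : Finite K := Nat.finite_of_card_ne_zero
      (by rw [hK]; exact pow_ne_zero _ (pow_ne_zero _ (Fact.out : p.Prime).ne_zero))
    exact le_antisymm (sup_le (sup_le varthetaGroup_le_stabGamma fieldAutPerms_le_stabGamma)
      zpowers_rho_le_stabGamma) (stabGamma_le hK)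
  commute := by
    rw [← range_pSigmaLHom]
    rintro _ ⟨x, rfl⟩ z hz
    exact pSigmaLHom_commute x ⟨z, hz⟩
  disjoint := by
    rw [← range_pSigmaLHom, Subgroup.disjoint_def]
    rintro _ ⟨x, rfl⟩ hx
    rw [eq_one_of_pSigmaLHom_mem_zpowers hx, map_one]

/-- The isomorphism `Γ ≅ PΣL(2,K) × ⟨ρ_{-1}⟩`. -/
theorem nonempty_stabGamma_mulEquiv [Fact p.Prime] [CharP K p]
    (hK : Nat.card K = (p ^ e) ^ 2) :
    Nonempty (stabGamma K p e ≃* PSigmaL K × Subgroup.zpowers (rho (-1 : SL(2, K)))) := by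
  have hdir := isInternalDirect_stabGamma hK
  let χ := (pSigmaLHom K p e).noncommCoprod (Subgroup.zpowers (rho (-1 : SL(2, K)))).subtype
    pSigmaLHom_commute
  have hinj : Function.Injective χ := by
    rw [MonoidHom.noncommCoprod_injective]
    refine ⟨pSigmaLHom_injective, Subtype.val_injective, ?_⟩
    rw [range_pSigmaLHom, Subgroup.range_subtype]
    exact hdir.disjoint
  have hrange : χ.range = stabGamma K p e := by
    rw [MonoidHom.noncommCoprod_range, range_pSigmaLHom, Subgroup.range_subtype]
    exact hdir.sup_eq
  exact ⟨((MonoidHom.ofInjective hinj).trans (MulEquiv.subgroupCongr hrange)).symm⟩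

theorem card_stabGamma [Fact p.Prime] [CharP K p] (hK : Nat.card K = (p ^ e) ^ 2) :
    Nat.card (stabGamma K p e) =
      2 * e * ((p ^ e) ^ 2 - 1) * (p ^ e) ^ 2 * ((p ^ e) ^ 2 + 1) := by
  have : Finite K := Nat.finite_of_card_ne_zero
    (by rw [hK]; exact pow_ne_zero _ (pow_ne_zero _ (Fact.out : p.Prime).ne_zero))
  obtain ⟨f⟩ := nonempty_stabGamma_mulEquiv hK
  have h1 := Subgroup.card_eq_card_quotient_mul_card_subgroup (Subgroup.center SL(2, K))
  have h2 : Nat.card (K ≃+* K) = 2 * e := card_ringAut (p := p) (by rw [hK, ← pow_mul, mul_comm])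
  rw [card_SL_two, hK, ← card_zpowers_rho (p := p)] at h1
  rw [Nat.card_congr f.toEquiv, Nat.card_prod, SemidirectProduct.card, h2, mul_right_comm, ← h1]
  generalize (p ^ e) ^ 2 = Q
  have : Q ^ 2 - 1 = (Q + 1) * (Q - 1) := Nat.sq_sub_sq Q 1
  rw [this]
  ring

end main

end SLUnital

theorem mainTheorem4 (p e : ℕ) [Fact p.Prime] (K : Type*) [Field K] [CharP K p]
    (hK : Nat.card K = (p ^ e) ^ 2) :
    IsInternalSemidirect (SLUnital.varthetaGroup K p e ⊔ SLUnital.fieldAutPerms K)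
      (SLUnital.varthetaGroup K p e) (SLUnital.fieldAutPerms K) ∧
    IsInternalDirect (SLUnital.stabGamma K p e)
      (SLUnital.varthetaGroup K p e ⊔ SLUnital.fieldAutPerms K)
      (Subgroup.zpowers (SLUnital.rho (-1 : SL(2, K)))) ∧
    Nonempty (SLUnital.stabGamma K p e ≃*
      SLUnital.PSigmaL K × Subgroup.zpowers (SLUnital.rho (-1 : SL(2, K)))) ∧
    (p ≠ 2 → Nonempty (SLUnital.stabGamma K p e ≃*
      SLUnital.PSigmaL K × Multiplicative (ZMod 2))) ∧
    (p = 2 → Subgroup.zpowers (SLUnital.rho (-1 : SL(2, K))) = ⊥ ∧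
      Nonempty (SLUnital.stabGamma K p e ≃* SLUnital.PSigmaL K)) ∧
    Nat.card (SLUnital.stabGamma K p e) =
      2 * e * ((p ^ e) ^ 2 - 1) * (p ^ e) ^ 2 * ((p ^ e) ^ 2 + 1) := by
  obtain ⟨f⟩ := SLUnital.nonempty_stabGamma_mulEquiv hK
  refine ⟨SLUnital.isInternalSemidirect_varthetaGroup, SLUnital.isInternalDirect_stabGamma hK,
    ⟨f⟩, fun hp => ?_, fun hp => ?_, SLUnital.card_stabGamma hK⟩
  · have hcard : Nat.card (Subgroup.zpowers (SLUnital.rho (-1 : SL(2, K)))) = 2 := by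
      rw [Nat.card_zpowers, SLUnital.orderOf_rho_neg_one hp]
    have g : Subgroup.zpowers (SLUnital.rho (-1 : SL(2, K))) ≃* Multiplicative (ZMod 2) :=
      mulEquivOfCyclicCardEq (by simp [hcard])
    exact ⟨f.trans (MulEquiv.prodCongr (MulEquiv.refl _) g)⟩
  · subst hp
    have hbot : Subgroup.zpowers (SLUnital.rho (-1 : SL(2, K))) = ⊥ := SLUnital.zpowers_rho_eq_bot
    have : Unique (Subgroup.zpowers (SLUnital.rho (-1 : SL(2, K)))) := by
      rw [hbot]
      infer_instance
    exact ⟨hbot, ⟨f.trans MulEquiv.prodUnique⟩⟩
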